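/- Let $\mathbb F$ be a field and let $q\in\mathbb F$ be nonzero and not a root of unity. Let $\mathbb V$ be the free $\mathbb F$-algebra on two noncommuting letters $x,y$; its words form a basis, and $1$ denotes the trivial word. Equip $\mathbb V$ with the $q$-shuffle product $\star$, the bilinear product with $1\star v=v\star 1=v$ and, for nontrivial words $u=u_1\cdots u_r$ and $v=v_1\cdots v_s$, $$u\star v=u_1\bigl((u_2\cdots u_r)\star v\bigr)+q^{\langle u_1,v_1\rangle+\cdots+\langle u_r,v_1\rangle}\,v_1\bigl(u\star(v_2\cdots v_s)\bigr),$$ where $\langle x,x\rangle=\langle y,y\rangle=2$ and $\langle x,y\rangle=\langle y,x\rangle=-2$. For $n\ge 0$ let $\tilde G_n=xyxy\cdots xy$ be the alternating word of length $2n$ (so $\tilde G_0=1$), and define $D_n\in\mathbb V$ recursively by $D_0=1$ and $D_0\star\tilde G_n+D_1\star\tilde G_{n-1}+\cdots+D_n\star\tilde G_0=0$ for $n\ge1$. Put $\overline x=1$, $\overline y=-1$ and $[m]_q=(q^m-q^{-m})/(q-q^{-1})$. A word $v_1\cdots v_{m}$ is Catalan if $\overline v_1+\cdots+\overline v_i\ge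 0$ for $1\le i\le m-1$ and $\overline v_1+\cdots+\overline v_m=0$. For $n\ge0$ let $$C_n=\sum v_1v_2\cdots v_{2n}\,[1]_q[1+\overline v_1]_q[1+\overline v_1+\overline v_2]_q\cdots[1+\overline v_1+\cdots+\overline v_{2n}]_q,$$ where the sum is over all Catalan words $v_1\cdots v_{2n}$ of length $2n$. Let $C(t)=\sum_{n\ge0}t^nC_n$ and $D(t)=\sum_{n\ge0}t^nD_n$ be the generating functions, as formal power series in $t$ over the $q$-shuffle algebra $(\mathbb V,\star)$. Then $$C(-t)=D(qt)\star D(q^{-1}t);$$ equivalently, for every $n\in\mathbb N$, $$C_n=(-1)^n\sum_{i=0}^n q^{2i-n}\,D_i\star D_{n-i}.$$ -/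

import Mathlib

/-- The two letters generating the free algebra. -/
inductive Letter where
  | x : Letter
  | y : Letter
  deriving DecidableEq

namespace Letter

instance : Fintype Letter := ⟨{x, y}, fun a => by cases a <;> simp⟩

/-- The symmetric pairing on letters: `⟨u, v⟩ = 2` if `u = v`, and `-2` otherwise. -/
def pairing (a b : Letter) : ℤ := if a = b then 2 else -2

/-- `x` has sign `1` and `y` has sign `-1`. -/
def sign : Letter → ℤ
  | x => 1
  | y => -1

end Letter

/-- The underlying vector space of the free algebra on `x, y`: the vector space having as basis
the words in `x, y`. The type remembers `q` since it carries the `q`-shuffle product. -/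
def QShuffle (F : Type*) [Field F] (_q : F) : Type _ := List Letter →₀ F

namespace QShuffle

noncomputable section

variable {F : Type*} [Field F] (q : F)

instance : AddCommGroup (QShuffle F q) := inferInstanceAs (AddCommGroup (List Letter →₀ F))

instance : Module F (QShuffle F q) := inferInstanceAs (Module F (List Letter →₀ F))

/-- The standard basis vector given by a word; the empty list is the trivial word. -/
def word (w : List Letter) : QShuffle F q := Finsupp.single w 1

/-- Linear extension of a function on words. -/
def extend {M : Type*} [AddCommMonoid M] [Module F M] (f : List Letter → M) :
    QShuffle F q →ₗ[F] M :=
  Finsupp.linearCombination F f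

@[simp] theorem extend_word {M : Type*} [AddCommMonoid M] [Module F M] (f : List Letter → M)
    (w : List Letter) : extend q f (word q w) = f w :=
  (Finsupp.linearCombination_single F 1 w).trans (one_smul F (f w))

theorem hom_ext {M : Type*} [AddCommMonoid M] [Module F M] {f g : QShuffle F q →ₗ[F] M}
    (h : ∀ w, f (word q w) = g (word q w)) : f = g :=
  Finsupp.lhom_ext' fun w => LinearMap.ext_ring (h w)

/-- Left multiplication by a letter in the free algebra. -/
def cons (a : Letter) : QShuffle F q →ₗ[F] QShuffle F q := extend q fun w => word q (a :: w)

/-- For a word `u = u₁ ⋯ u_r` and a letter `b`, the scalar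
`q ^ (⟨u₁, b⟩ + ⋯ + ⟨u_r, b⟩)`, written as a product of powers of `q`. -/
def weight (u : List Letter) (b : Letter) : F := (u.map fun a => q ^ Letter.pairing a b).prod

/-- The `q`-shuffle product of two words, by recursion on the first letters. -/
def shuffleWord : List Letter → List Letter → QShuffle F q
  | [], v => word q v
  | a :: u, [] => word q (a :: u)
  | a :: u, b :: v =>
      cons q a (shuffleWord u (b :: v)) + weight q (a :: u) b • cons q b (shuffleWord (a :: u) v)
  termination_by u v => u.length + v.length

/-- The `q`-shuffle product, as a bilinear map. -/
def star : QShuffle F q →ₗ[F] QShuffle F q →ₗ[F] QShuffle F q :=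
  extend q fun u => extend q fun v => shuffleWord q u v

theorem star_word_word (u v : List Letter) :
    star q (word q u) (word q v) = shuffleWord q u v := by
  simp [star]

theorem cons_word (a : Letter) (w : List Letter) : cons q a (word q w) = word q (a :: w) := by
  simp [cons]

theorem star_nil_left (f : QShuffle F q) : star q (word q []) f = f := by
  have : star q (word q []) = LinearMap.id := hom_ext q fun w => by
    simp [star_word_word, shuffleWord]
  simp [this]

theorem shuffleWord_nil_right (u : List Letter) : shuffleWord q u [] = word q u := by
  cases u <;> simp [shuffleWord]

theorem star_nil_right (f : QShuffle F q) : star q f (word q []) = f := by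
  have : (star q).flip (word q []) = LinearMap.id := hom_ext q fun w => by
    simp [star_word_word, shuffleWord_nil_right]
  simpa using LinearMap.congr_fun this f

/-- Rescaling each word `w` by `weight q w b`. -/
def twist (b : Letter) : QShuffle F q →ₗ[F] QShuffle F q :=
  extend q fun w => weight q w b • word q w

theorem twist_cons (a b : Letter) (f : QShuffle F q) :
    twist q b (cons q a f) = q ^ Letter.pairing a b • cons q a (twist q b f) := by
  have : twist q b ∘ₗ cons q a = q ^ Letter.pairing a b • (cons q a ∘ₗ twist q b) :=
    hom_ext q fun w => by simp [twist, cons, weight, mul_smul]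
  simpa using LinearMap.congr_fun this f

theorem twist_shuffleWord (c : Letter) (u v : List Letter) :
    twist q c (shuffleWord q u v) = (weight q u c * weight q v c) • shuffleWord q u v := by
  induction u, v using shuffleWord.induct with
  | case1 v => simp [shuffleWord, twist, weight]
  | case2 a u => simp [shuffleWord, twist, weight]
  | case3 a u b v ih1 ih2 =>
    have e (a : Letter) (u : List Letter) :
        weight q (a :: u) c = q ^ Letter.pairing a c * weight q u c := by simp [weight]
    rw [shuffleWord, map_add, map_smul, twist_cons, twist_cons, ih1, ih2, e a u, e b v]
    simp only [map_smul, smul_smul, smul_add]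
    congr 2 <;> ring

theorem star_word_cons (a b : Letter) (u : List Letter) (g : QShuffle F q) :
    star q (word q (a :: u)) (cons q b g) =
      cons q a (star q (word q u) (cons q b g)) +
        weight q (a :: u) b • cons q b (star q (word q (a :: u)) g) := by
  have : star q (word q (a :: u)) ∘ₗ cons q b =
      cons q a ∘ₗ star q (word q u) ∘ₗ cons q b +
        weight q (a :: u) b • (cons q b ∘ₗ star q (word q (a :: u))) :=
    hom_ext q fun v => by simp [cons_word, star_word_word, shuffleWord]
  simpa using LinearMap.congr_fun this g

theorem star_cons_word (a c : Letter) (f : QShuffle F q) (w : List Letter) :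
    star q (cons q a f) (word q (c :: w)) =
      cons q a (star q f (word q (c :: w))) +
        cons q c (star q (twist q c (cons q a f)) (word q w)) := by
  have : (star q).flip (word q (c :: w)) ∘ₗ cons q a =
      cons q a ∘ₗ (star q).flip (word q (c :: w)) +
        cons q c ∘ₗ (star q).flip (word q w) ∘ₗ twist q c ∘ₗ cons q a :=
    hom_ext q fun u => by simp [cons_word, star_word_word, shuffleWord, twist]
  simpa using LinearMap.congr_fun this f

theorem star_assoc_word (u v w : List Letter) :
    star q (star q (word q u) (word q v)) (word q w) =
      star q (word q u) (star q (word q v) (word q w)) := by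
  match u, v, w with
  | [], v, w => simp [star_nil_left]
  | a :: u, [], w => simp [star_nil_left, star_nil_right]
  | a :: u, b :: v, [] => simp [star_nil_right]
  | a :: u, b :: v, c :: w =>
    have h1 := star_assoc_word u (b :: v) (c :: w)
    have h2 := star_assoc_word (a :: u) v (c :: w)
    have h3 := star_assoc_word (a :: u) (b :: v) w
    have e (a b : Letter) (u v : List Letter) :
        star q (word q (a :: u)) (word q (b :: v)) =
          cons q a (star q (word q u) (word q (b :: v))) +
            weight q (a :: u) b • cons q b (star q (word q (a :: u)) (word q v)) := by
      simp only [star_word_word, shuffleWord]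
    have t : twist q c (star q (word q (a :: u)) (word q (b :: v))) =
        (weight q (a :: u) c * weight q (b :: v) c) •
          star q (word q (a :: u)) (word q (b :: v)) := by
      rw [star_word_word, twist_shuffleWord]
    have l : star q (star q (word q (a :: u)) (word q (b :: v))) (word q (c :: w)) =
        cons q a (star q (star q (word q u) (word q (b :: v))) (word q (c :: w))) +
        weight q (a :: u) b •
          cons q b (star q (star q (word q (a :: u)) (word q v)) (word q (c :: w))) +
        cons q c (star q (twist q c (star q (word q (a :: u)) (word q (b :: v))))
          (word q w)) := by
      rw [e a b u v]
      simp only [map_add, map_smul, LinearMap.add_apply, LinearMap.smul_apply, star_cons_word,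
        smul_add]
      abel
    rw [l, t, h1, h2, e b c v w]
    simp only [map_add, map_smul, LinearMap.smul_apply, star_word_cons, h3, smul_add, smul_smul]
    rw [mul_comm (weight q (a :: u) c) (weight q (b :: v) c)]
    abel
  termination_by u.length + v.length + w.length

theorem star_assoc (f g h : QShuffle F q) :
    star q (star q f g) h = star q f (star q g h) := by
  have h1 (u v : List Letter) : star q (star q (word q u) (word q v)) =
      star q (word q u) ∘ₗ star q (word q v) :=
    hom_ext q fun w => star_assoc_word q u v w
  have h2 (u : List Letter) : (star q).flip h ∘ₗ star q (word q u) =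
      star q (word q u) ∘ₗ (star q).flip h :=
    hom_ext q fun v => by simpa using LinearMap.congr_fun (h1 u v) h
  have h3 : (star q).flip h ∘ₗ (star q).flip g = (star q).flip (star q g h) :=
    hom_ext q fun u => by simpa using LinearMap.congr_fun (h2 u) g
  simpa using LinearMap.congr_fun h3 f

instance : Mul (QShuffle F q) := ⟨fun f g => star q f g⟩

instance : One (QShuffle F q) := ⟨word q []⟩

/-- The `q`-shuffle algebra: its product `*` is the `q`-shuffle product, and its unit is the
trivial word. -/
instance : Ring (QShuffle F q) where
  __ : AddCommGroup (QShuffle F q) := inferInstance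
  left_distrib f g h := map_add (star q f) g h
  right_distrib f g h := LinearMap.map_add₂ (star q) f g h
  zero_mul f := LinearMap.map_zero₂ (star q) f
  mul_zero f := map_zero (star q f)
  mul_assoc f g h := star_assoc q f g h
  one_mul f := star_nil_left q f
  mul_one f := star_nil_right q f

instance : Algebra F (QShuffle F q) :=
  Algebra.ofModule (fun r f g => LinearMap.map_smul₂ (star q) r f g)
    (fun r f g => map_smul (star q f) r g)

/-- The letters of the alternating word `xyxy⋯xy` of length `2n`. -/
def xyWord : ℕ → List Letter
  | 0 => []
  | n + 1 => Letter.x :: Letter.y :: xyWord n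

/-- The alternating word `G̃ₙ = xyxy⋯xy` of length `2n`, with `G̃₀ = 1`. -/
def Gtilde (n : ℕ) : QShuffle F q := word q (xyWord n)

/-- The elements `Dₙ`, determined by `D₀ = 1` and, for `n ≥ 1`,
`D₀ ⋆ G̃ₙ + D₁ ⋆ G̃ₙ₋₁ + ⋯ + Dₙ ⋆ G̃₀ = 0`. -/
def D : ℕ → QShuffle F q
  | 0 => 1
  | n + 1 => -∑ i : Fin (n + 1), D i * Gtilde q (n + 1 - i)

theorem D_recurrence (n : ℕ) (hn : 1 ≤ n) :
    ∑ i ∈ Finset.range (n + 1), D q i * Gtilde q (n - i) = 0 := by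
  obtain ⟨m, rfl⟩ : ∃ m, n = m + 1 := ⟨n - 1, by omega⟩
  have h0 : (Gtilde q 0 : QShuffle F q) = 1 := rfl
  rw [Finset.sum_range_succ, Nat.sub_self, h0, mul_one, D, Finset.sum_range]
  exact add_neg_cancel _

/-- The `q`-integer `[n]_q`. -/
def qInt (n : ℤ) : F := (q ^ n - q ^ (-n)) / (q - q⁻¹)

/-- The sum of the signs of the letters of a word. -/
def height (w : List Letter) : ℤ := (w.map Letter.sign).sum

/-- A word is Catalan if all its initial segments have nonnegative height, and its own height
is zero. -/
def IsCatalan (w : List Letter) : Prop :=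
  (∀ i ∈ Finset.range w.length, 0 ≤ height (w.take i)) ∧ height w = 0

instance : DecidablePred IsCatalan := fun w => by unfold IsCatalan; infer_instance

/-- The scalar `[1]_q [1 + v̄₁]_q [1 + v̄₁ + v̄₂]_q ⋯ [1 + v̄₁ + ⋯ + v̄ₘ]_q` attached to a word
`v₁ v₂ ⋯ vₘ`, where `v̄` is the sign of the letter `v`. -/
def catalanCoeff (w : List Letter) : F :=
  ∏ i ∈ Finset.range (w.length + 1), qInt q (1 + height (w.take i))

/-- The element `Cₙ`: the sum of the Catalan words of length `2n`, each multiplied by its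
scalar `catalanCoeff`. -/
def C (n : ℕ) : QShuffle F q :=
  ∑ v : Fin (2 * n) → Letter,
    if IsCatalan (List.ofFn v) then catalanCoeff q (List.ofFn v) • word q (List.ofFn v) else 0

/-- For a sequence `a₀, a₁, …` in the `q`-shuffle algebra and a scalar `c`, the formal power
series `∑ₙ (c t)ⁿ aₙ`, i.e. the generating function of the sequence evaluated at `c t`. -/
def genFun (a : ℕ → QShuffle F q) (c : F) : PowerSeries (QShuffle F q) :=
  PowerSeries.mk fun n => c ^ n • a n

end

end QShuffle

namespace QShuffle

noncomputable section

variable {F : Type*} [Field F] (q : F)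

/-! Deleting a first letter `a` is a skew derivation of the shuffle product, and an element is
determined by its counit and its two deletions. So coefficients of products can be computed letter
by letter. Write G(s), W(s), D(s) for the generating functions of xy⋯xy, of yxy⋯xy and of `D`,
evaluated at st; thus D(s) is the inverse of G(s). Comparing deletions gives W(q⁻¹)G(q) =
G(q⁻¹)W(q), hence one series Z = D(q⁻¹)W(q⁻¹) = W(q)D(q). It satisfies a Riccati system: deleting y
sends Z to 1, and deleting x sends it to -q⁻¹tZ².

Consequently the span of P_h = q^(-h(h-1)/2) D(q) Z^h D(q⁻¹) over F[t] is closed under deletion: y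
takes P_(h+1) to [h+1]P_h and kills P_0, while x takes P_h to -t[h+2]P_(h+1). Reading a word from
the left therefore walks along a path from height h, each step weighted by [1 + new height], and the
counit keeps only paths ending at 0. For h = 0 these are the Catalan words with the weights defining
`C`, each x supplying a factor -t, and P_0 = D(q)D(q⁻¹). -/

/-! ### Word coefficients and skew derivations -/

/-- The coefficient of a word. -/
def wordCoeff (w : List Letter) : QShuffle F q →ₗ[F] F := Finsupp.lapply w

theorem wordCoeff_word (w v : List Letter) :
    wordCoeff q w (word q v) = if v = w then 1 else 0 :=
  Finsupp.single_apply

theorem ext_wordCoeff {f g : QShuffle F q} (h : ∀ w, wordCoeff q w f = wordCoeff q w g) :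
    f = g :=
  Finsupp.ext h

/-- The skew derivation deleting the first letter of a word if it equals `a`, and killing the
word otherwise. -/
def del (a : Letter) : QShuffle F q →ₗ[F] QShuffle F q :=
  extend q fun w => match w with
    | [] => 0
    | b :: w => if b = a then word q w else 0

@[simp] theorem del_one (a : Letter) : del q a 1 = 0 := extend_word q _ []

theorem del_word_cons (a b : Letter) (w : List Letter) :
    del q a (word q (b :: w)) = if b = a then word q w else 0 := extend_word q _ _

theorem del_cons (a b : Letter) (f : QShuffle F q) :
    del q a (cons q b f) = if b = a then f else 0 := by
  have : del q a ∘ₗ cons q b = if b = a then LinearMap.id else 0 := hom_ext q fun w => by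
    simp only [LinearMap.comp_apply, cons_word, del_word_cons]
    split_ifs <;> rfl
  have := LinearMap.congr_fun this f
  simp only [LinearMap.comp_apply] at this
  rw [this]
  split_ifs <;> rfl

theorem twist_word (a : Letter) (w : List Letter) :
    twist q a (word q w) = weight q w a • word q w := extend_word q _ _

theorem bilinear_ext {M : Type*} [AddCommMonoid M] [Module F M]
    {B B' : QShuffle F q →ₗ[F] QShuffle F q →ₗ[F] M}
    (h : ∀ u v, B (word q u) (word q v) = B' (word q u) (word q v)) : B = B' :=
  hom_ext q fun u => hom_ext q fun v => h u v

/-- The weight depends only on the multiset of letters, which shuffling preserves. -/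
theorem twist_mul (a : Letter) (f g : QShuffle F q) :
    twist q a (f * g) = twist q a f * twist q a g := by
  have : (star q).compr₂ (twist q a) = (star q).compl₁₂ (twist q a) (twist q a) :=
    bilinear_ext q fun u v => by
      simp only [LinearMap.compr₂_apply, LinearMap.compl₁₂_apply, twist_word, map_smul,
        LinearMap.smul_apply, star_word_word, twist_shuffleWord, smul_smul]
      rw [mul_comm]
  exact LinearMap.congr_fun₂ this f g

/-- A shuffle starts with the first letter of `f`, or with that of `g`, which then has crossed all
of `f`; the twist records the cost of this crossing. -/
theorem del_mul (a : Letter) (f g : QShuffle F q) :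
    del q a (f * g) = del q a f * g + twist q a f * del q a g := by
  have : (star q).compr₂ (del q a) =
      (star q).compl₁₂ (del q a) LinearMap.id + (star q).compl₁₂ (twist q a) (del q a) :=
    bilinear_ext q fun u v => by
      have hnil : del q a (word q []) = 0 := del_one q a
      simp only [LinearMap.compr₂_apply, LinearMap.compl₁₂_apply, LinearMap.add_apply,
        LinearMap.id_apply, twist_word, map_smul, LinearMap.smul_apply]
      match u, v with
      | [], v => simp [hnil, star_nil_left, weight]
      | b :: u, [] => simp [hnil, star_nil_right]
      | b :: u, c :: v =>
        rw [star_word_word, shuffleWord, map_add, map_smul, del_cons, del_cons, del_word_cons,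
          del_word_cons]
        by_cases hb : b = a <;> by_cases hc : c = a <;> simp [hb, hc, star_word_word]
  exact LinearMap.congr_fun₂ this f g

theorem wordCoeff_cons (a : Letter) (w : List Letter) (f : QShuffle F q) :
    wordCoeff q (a :: w) f = wordCoeff q w (del q a f) := by
  have : wordCoeff q (a :: w) = wordCoeff q w ∘ₗ del q a := hom_ext q fun v => by
    rw [LinearMap.comp_apply]
    cases v with
    | nil => rw [show del q a (word q []) = 0 from del_one q a]; simp [wordCoeff_word]
    | cons b v =>
      rw [del_word_cons, wordCoeff_word]
      by_cases hb : b = a <;> simp [hb, wordCoeff_word]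
  exact LinearMap.congr_fun this f

theorem wordCoeff_nil_mul (f g : QShuffle F q) :
    wordCoeff q [] (f * g) = wordCoeff q [] f * wordCoeff q [] g := by
  have : (star q).compr₂ (wordCoeff q []) =
      (LinearMap.mul F F).compl₁₂ (wordCoeff q []) (wordCoeff q []) :=
    bilinear_ext q fun u v => by
      have hcons (a : Letter) (f : QShuffle F q) : wordCoeff q [] (cons q a f) = 0 := by
        have : wordCoeff q [] ∘ₗ cons q a = 0 := hom_ext q fun w => by
          simp [cons_word, wordCoeff_word]
        exact LinearMap.congr_fun this f
      simp only [LinearMap.compr₂_apply, LinearMap.compl₁₂_apply, LinearMap.mul_apply']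
      match u, v with
      | [], v => simp [star_nil_left, wordCoeff_word]
      | b :: u, [] => simp [star_nil_right, wordCoeff_word]
      | b :: u, c :: v => simp [star_word_word, shuffleWord, hcons, wordCoeff_word]
  exact LinearMap.congr_fun₂ this f g

/-- The counit of the `q`-shuffle algebra, taking the coefficient of the trivial word. -/
def counit : QShuffle F q →+* F where
  toFun := wordCoeff q []
  map_one' := (wordCoeff_word q [] []).trans (if_pos rfl)
  map_mul' := wordCoeff_nil_mul q
  map_zero' := map_zero _
  map_add' := map_add _

theorem counit_apply (f : QShuffle F q) : counit q f = wordCoeff q [] f := rfl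

/-! ### Skew derivations on power series -/

/-- Coefficientwise application of a linear map to a power series. -/
def mapCoeff (L : QShuffle F q →ₗ[F] QShuffle F q) :
    PowerSeries (QShuffle F q) →ₗ[F] PowerSeries (QShuffle F q) where
  toFun p := PowerSeries.mk fun n => L (PowerSeries.coeff n p)
  map_add' p r := by ext n; simp
  map_smul' c p := by ext n; simp

@[simp] theorem coeff_mapCoeff (L : QShuffle F q →ₗ[F] QShuffle F q) (n : ℕ)
    (p : PowerSeries (QShuffle F q)) :
    PowerSeries.coeff n (mapCoeff q L p) = L (PowerSeries.coeff n p) := by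
  simp [mapCoeff]

/-- Coefficientwise deletion of a first letter. -/
abbrev delS (a : Letter) := mapCoeff q (del q a)

/-- Coefficientwise twist. -/
abbrev twistS (a : Letter) := mapCoeff q (twist q a)

theorem delS_mul (a : Letter) (f g : PowerSeries (QShuffle F q)) :
    delS q a (f * g) = delS q a f * g + twistS q a f * delS q a g := by
  ext n
  simp [PowerSeries.coeff_mul, del_mul, Finset.sum_add_distrib]

theorem twistS_mul (a : Letter) (f g : PowerSeries (QShuffle F q)) :
    twistS q a (f * g) = twistS q a f * twistS q a g := by
  ext n
  simp [PowerSeries.coeff_mul, twist_mul]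

@[simp] theorem delS_one (a : Letter) : delS q a 1 = 0 := by
  ext n
  cases n <;> simp [PowerSeries.coeff_one]

@[simp] theorem twistS_one (a : Letter) : twistS q a 1 = 1 := by
  ext n
  have : twist q a 1 = 1 := (twist_word q a []).trans (by simp [weight]; rfl)
  cases n <;> simp [PowerSeries.coeff_one, this]

/-- Two power series agree if they have the same counit and the same first-letter deletions. -/
theorem ext_delS {f g : PowerSeries (QShuffle F q)}
    (h0 : PowerSeries.map (counit q) f = PowerSeries.map (counit q) g)
    (h : ∀ a, delS q a f = delS q a g) : f = g := by
  ext n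
  refine ext_wordCoeff q fun w => ?_
  cases w with
  | nil => simpa [counit_apply] using congrArg (PowerSeries.coeff n) h0
  | cons a w =>
    rw [wordCoeff_cons, wordCoeff_cons]
    simpa using congrArg (fun p => wordCoeff q w (PowerSeries.coeff n p)) (h a)

/-! ### The alternating series and their deletions -/

/-- The generating function of the words `xyxy⋯xy`. -/
abbrev gSeries (s : F) : PowerSeries (QShuffle F q) := genFun q (Gtilde q) s

/-- The generating function of the words `yxy⋯xy`. -/
def wSeries (s : F) : PowerSeries (QShuffle F q) :=
  genFun q (fun n => word q (Letter.y :: xyWord n)) s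

/-- The generating function of the elements `Dₙ`. -/
abbrev dSeries (s : F) : PowerSeries (QShuffle F q) := genFun q (D q) s

@[simp] theorem coeff_genFun (a : ℕ → QShuffle F q) (s : F) (n : ℕ) :
    PowerSeries.coeff n (genFun q a s) = s ^ n • a n :=
  PowerSeries.coeff_mk _ _

theorem dSeries_mul_gSeries (s : F) : dSeries q s * gSeries q s = 1 := by
  ext n
  rw [PowerSeries.coeff_mul, Finset.Nat.sum_antidiagonal_eq_sum_range_succ_mk,
    PowerSeries.coeff_one]
  have h : ∀ i ∈ Finset.range (n + 1), PowerSeries.coeff i (dSeries q s) *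
      PowerSeries.coeff (n - i) (gSeries q s) = s ^ n • (D q i * Gtilde q (n - i)) := by
    intro i hi
    have hi : i ≤ n := by simpa [Nat.lt_succ_iff] using hi
    rw [coeff_genFun, coeff_genFun, smul_mul_smul_comm, ← pow_add, Nat.add_sub_cancel' hi]
  rw [Finset.sum_congr rfl h, ← Finset.smul_sum]
  rcases Nat.eq_zero_or_pos n with rfl | hn
  · have h0 : (Gtilde q 0 : QShuffle F q) = 1 := rfl
    simp [h0, D]
  · rw [D_recurrence q n hn, smul_zero, if_neg hn.ne']

/-- The recurrence gives only a left inverse in a noncommutative ring. Constant term 1 supplies a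
right inverse, and the two must agree. -/
theorem gSeries_mul_dSeries (s : F) : gSeries q s * dSeries q s = 1 := by
  have h0 : PowerSeries.constantCoeff (gSeries q s) = ((1 : (QShuffle F q)ˣ) : QShuffle F q) := by
    have h0 : (Gtilde q 0 : QShuffle F q) = 1 := rfl
    rw [← PowerSeries.coeff_zero_eq_constantCoeff_apply, coeff_genFun, h0]
    simp
  have h1 := PowerSeries.mul_invOfUnit _ _ h0
  rwa [← left_inv_eq_right_inv (dSeries_mul_gSeries q s) h1] at h1

theorem delS_x_gSeries (s : F) :
    delS q .x (gSeries q s) = s • (PowerSeries.X * wSeries q s) := by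
  ext n
  cases n with
  | zero =>
    rw [coeff_mapCoeff, coeff_genFun, map_smul, PowerSeries.coeff_smul,
      PowerSeries.coeff_zero_X_mul, show del q .x (Gtilde q 0) = 0 from del_one q _]
    simp
  | succ n =>
    rw [coeff_mapCoeff, coeff_genFun, map_smul, PowerSeries.coeff_smul,
      PowerSeries.coeff_succ_X_mul, wSeries, coeff_genFun, Gtilde, xyWord, del_word_cons,
      if_pos rfl, smul_smul, pow_succ']

theorem delS_y_gSeries (s : F) : delS q .y (gSeries q s) = 0 := by
  ext n
  rw [coeff_mapCoeff, coeff_genFun, map_smul, map_zero]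
  cases n with
  | zero => rw [show del q .y (Gtilde q 0) = 0 from del_one q _, smul_zero]
  | succ n => rw [Gtilde, xyWord, del_word_cons, if_neg (by decide), smul_zero]

theorem delS_x_wSeries (s : F) : delS q .x (wSeries q s) = 0 := by
  ext n
  rw [coeff_mapCoeff, wSeries, coeff_genFun, map_smul, del_word_cons, if_neg (by decide)]
  simp

theorem delS_y_wSeries (s : F) : delS q .y (wSeries q s) = gSeries q s := by
  ext n
  rw [coeff_mapCoeff, wSeries, coeff_genFun, map_smul, del_word_cons, if_pos rfl, coeff_genFun,
    Gtilde]

variable {q}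

/-- The pairings of x and y with any fixed letter cancel, so balanced words are untouched by twists.
-/
theorem weight_xyWord (hq0 : q ≠ 0) (a : Letter) (n : ℕ) : weight q (xyWord n) a = 1 := by
  induction n with
  | zero => simp [xyWord, weight]
  | succ n ih =>
    have : weight q (xyWord (n + 1)) a =
        q ^ Letter.pairing .x a * (q ^ Letter.pairing .y a * weight q (xyWord n) a) := by
      simp [xyWord, weight]
    rw [this, ih, mul_one, ← zpow_add₀ hq0]
    cases a <;> simp [Letter.pairing]

theorem twistS_gSeries (hq0 : q ≠ 0) (a : Letter) (s : F) :
    twistS q a (gSeries q s) = gSeries q s := by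
  ext n
  rw [coeff_mapCoeff, coeff_genFun, map_smul, Gtilde, twist_word, weight_xyWord hq0, one_smul]

theorem twistS_wSeries (hq0 : q ≠ 0) (a : Letter) (s : F) :
    twistS q a (wSeries q s) = q ^ Letter.pairing .y a • wSeries q s := by
  ext n
  have : weight q (.y :: xyWord n) a = q ^ Letter.pairing .y a := by
    rw [← mul_one (q ^ Letter.pairing .y a), ← weight_xyWord hq0 a n]
    simp [weight]
  rw [coeff_mapCoeff, PowerSeries.coeff_smul, wSeries, coeff_genFun, map_smul, twist_word, this,
    smul_comm]

theorem twistS_dSeries (hq0 : q ≠ 0) (a : Letter) (s : F) :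
    twistS q a (dSeries q s) = dSeries q s := by
  have h := congrArg (twistS q a) (dSeries_mul_gSeries q s)
  rw [twistS_mul, twistS_gSeries hq0, twistS_one] at h
  exact left_inv_eq_right_inv h (gSeries_mul_dSeries q s)

/-- The derivative of an inverse, from differentiating DG = 1; no twist survives because D is fixed
by it. -/
theorem delS_dSeries (hq0 : q ≠ 0) (a : Letter) (s : F) :
    delS q a (dSeries q s) = -(dSeries q s * delS q a (gSeries q s) * dSeries q s) := by
  have h := congrArg (delS q a) (dSeries_mul_gSeries q s)
  rw [delS_mul, twistS_dSeries hq0, delS_one] at h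
  have h := congrArg (· * dSeries q s) (eq_neg_of_add_eq_zero_left h)
  simpa [mul_assoc, gSeries_mul_dSeries] using h

theorem delS_y_dSeries (hq0 : q ≠ 0) (s : F) : delS q .y (dSeries q s) = 0 := by
  simp [delS_dSeries hq0, delS_y_gSeries]

theorem delS_x_dSeries (hq0 : q ≠ 0) (s : F) :
    delS q .x (dSeries q s) =
      -(s • (PowerSeries.X * (dSeries q s * wSeries q s * dSeries q s))) := by
  rw [delS_dSeries hq0, delS_x_gSeries, mul_smul_comm, smul_mul_assoc, ← mul_assoc (dSeries q s),
    (PowerSeries.commute_X (dSeries q s)).eq]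
  simp only [mul_assoc]

theorem map_counit_wSeries (s : F) : PowerSeries.map (counit q) (wSeries q s) = 0 := by
  ext n
  have : counit q (s ^ n • word q (.y :: xyWord n)) = 0 := by
    simp [counit_apply, wordCoeff_word]
  rw [PowerSeries.coeff_map, wSeries, coeff_genFun, this, map_zero]

theorem map_counit_gSeries (s : F) : PowerSeries.map (counit q) (gSeries q s) = 1 := by
  ext n
  have : counit q (s ^ n • Gtilde q n) = if n = 0 then 1 else 0 := by
    cases n <;> simp [counit_apply, Gtilde, xyWord, wordCoeff_word]
  rw [PowerSeries.coeff_map, coeff_genFun, this, PowerSeries.coeff_one]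

theorem map_counit_dSeries (s : F) : PowerSeries.map (counit q) (dSeries q s) = 1 := by
  have h := congrArg (PowerSeries.map (counit q)) (dSeries_mul_gSeries q s)
  rwa [map_mul, map_counit_gSeries, mul_one, map_one] at h

/-! ### The exchange relation and the series Z -/

/-- Both sides have counit 0 and equal deletions. For x, the twist of W contributes q⁻², which turns
the factor q from G(q) into the q⁻¹ coming from G(q⁻¹); this is why the arguments q and q⁻¹ are
paired. -/
theorem wSeries_mul_gSeries (hq0 : q ≠ 0) :
    wSeries q q⁻¹ * gSeries q q = gSeries q q⁻¹ * wSeries q q := by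
  refine ext_delS q (by simp only [map_mul, map_counit_wSeries, zero_mul, mul_zero]) fun a => ?_
  have hy : q ^ Letter.pairing .y .x * q = q⁻¹ := by
    rw [Letter.pairing, if_neg (by decide)]
    field_simp
  cases a with
  | x =>
    rw [delS_mul, delS_mul, delS_x_wSeries, delS_x_wSeries, delS_x_gSeries, delS_x_gSeries,
      twistS_wSeries hq0, zero_mul, mul_zero, zero_add, add_zero, smul_mul_smul_comm, hy,
      smul_mul_assoc, ← mul_assoc, (PowerSeries.commute_X (wSeries q q⁻¹)).eq]
  | y =>
    rw [delS_mul, delS_mul, delS_y_wSeries, delS_y_wSeries, delS_y_gSeries, delS_y_gSeries,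
      twistS_gSeries hq0, zero_mul, mul_zero, zero_add, add_zero]

variable (q) in
/-- The quotient `D(q⁻¹t) W(q⁻¹t) = W(qt) D(qt)`. -/
def zSeries : PowerSeries (QShuffle F q) := dSeries q q⁻¹ * wSeries q q⁻¹

theorem zSeries_eq (hq0 : q ≠ 0) : zSeries q = wSeries q q * dSeries q q := by
  have h := congrArg (fun p => dSeries q q⁻¹ * p * dSeries q q) (wSeries_mul_gSeries hq0)
  simp only [← mul_assoc, dSeries_mul_gSeries, one_mul] at h
  simpa only [zSeries, mul_assoc, gSeries_mul_dSeries, mul_one] using h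

theorem delS_y_zSeries (hq0 : q ≠ 0) : delS q .y (zSeries q) = 1 := by
  rw [zSeries, delS_mul, delS_y_dSeries hq0, delS_y_wSeries, twistS_dSeries hq0, zero_mul,
    zero_add, dSeries_mul_gSeries]

theorem delS_x_zSeries (hq0 : q ≠ 0) :
    delS q .x (zSeries q) = -(q⁻¹ • (PowerSeries.X * (zSeries q * zSeries q))) := by
  rw [zSeries, delS_mul, delS_x_dSeries hq0, delS_x_wSeries]
  simp only [mul_assoc, mul_zero, add_zero, neg_mul, smul_mul_assoc]

theorem twistS_zSeries (hq0 : q ≠ 0) (a : Letter) :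
    twistS q a (zSeries q) = q ^ Letter.pairing .y a • zSeries q := by
  rw [zSeries, twistS_mul, twistS_dSeries hq0, twistS_wSeries hq0, mul_smul_comm]

/-- Each factor Z passed by the derivation contributes q², producing a geometric sum. At `h = 0` the
truncated exponent is harmless since the sum is empty. -/
theorem delS_y_pow_mul (hq0 : q ≠ 0) (h : ℕ) :
    delS q .y (zSeries q ^ h * dSeries q q⁻¹) =
      (∑ i ∈ Finset.range h, q ^ (2 * i)) • (zSeries q ^ (h - 1) * dSeries q q⁻¹) := by
  induction h with
  | zero => simp [delS_y_dSeries hq0]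
  | succ h ih =>
    rw [pow_succ', mul_assoc, delS_mul, ih, delS_y_zSeries hq0, twistS_zSeries hq0, one_mul,
      Letter.pairing, if_pos rfl, smul_mul_smul_comm, ← mul_assoc, ← pow_succ',
      Finset.sum_range_succ', add_smul, add_comm]
    cases h with
    | zero => simp
    | succ h =>
      have (i : ℕ) : q ^ (2 * (i + 1)) = q ^ 2 * q ^ (2 * i) := by rw [← pow_add]; congr 1; ring
      simp [this, Finset.mul_sum]

/-- Now each Z passed contributes q⁻². There is one more term than factors of Z, since the final
D(q⁻¹) also has a nonzero x-deletion. -/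
theorem delS_x_pow_mul (hq0 : q ≠ 0) (h : ℕ) :
    delS q .x (zSeries q ^ h * dSeries q q⁻¹) =
      -((q⁻¹ * ∑ i ∈ Finset.range (h + 1), q⁻¹ ^ (2 * i)) •
        (PowerSeries.X * (zSeries q ^ (h + 1) * dSeries q q⁻¹))) := by
  induction h with
  | zero => simp [delS_x_dSeries hq0, zSeries]
  | succ h ih =>
    have hp : q ^ Letter.pairing .y .x = q⁻¹ ^ 2 := by
      rw [Letter.pairing, if_neg (by decide)]
      simp
    rw [pow_succ', mul_assoc, delS_mul, ih, delS_x_zSeries hq0, twistS_zSeries hq0, hp,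
      Finset.sum_range_succ' _ (h + 1), mul_neg, smul_mul_smul_comm,
      ← mul_assoc (zSeries q) PowerSeries.X,
      (PowerSeries.commute_X (zSeries q)).eq, neg_mul, smul_mul_assoc, pow_succ' _ (h + 1),
      pow_succ' _ h]
    simp only [mul_assoc, ← neg_add, ← add_smul]
    congr 2
    have (i : ℕ) : q⁻¹ ^ (2 * (i + 1)) = q⁻¹ ^ 2 * q⁻¹ ^ (2 * i) := by rw [← pow_add]; congr 1; ring
    simp only [this, ← Finset.mul_sum]
    ring

/-! ### Path series and their word coefficients -/

theorem qInt_eq_sum (hq0 : q ≠ 0) (hq2 : q ^ 2 ≠ 1) (n : ℕ) :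
    q ^ n * qInt q (n + 1) = ∑ i ∈ Finset.range (n + 1), q ^ (2 * i) := by
  have hd : q - q⁻¹ ≠ 0 := by
    intro h
    apply hq2
    field_simp at h
    linear_combination h
  simp only [pow_mul]
  rw [geom_sum_eq hq2, qInt]
  have h1 : q ^ 2 - 1 ≠ 0 := sub_ne_zero.2 hq2
  have e1 : q ^ ((n : ℤ) + 1) = q ^ (n + 1) := by norm_cast
  have e2 : q ^ (-((n : ℤ) + 1)) = (q ^ (n + 1))⁻¹ := by rw [zpow_neg, e1]
  rw [e1, e2]
  have e3 : q - q⁻¹ = (q ^ 2 - 1) / q := by field_simp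
  rw [e3]
  field_simp
  ring

variable (q) in
/-- The series `q^(-h(h-1)/2) D(qt) Z^h D(q⁻¹t)`, which enumerates weighted nonnegative paths from
height `h` to `0`. -/
def pathSeries (h : ℕ) : PowerSeries (QShuffle F q) :=
  q⁻¹ ^ h.choose 2 • (dSeries q q * (zSeries q ^ h * dSeries q q⁻¹))

theorem delS_y_pathSeries_zero (hq0 : q ≠ 0) : delS q .y (pathSeries q 0) = 0 := by
  simp [pathSeries, delS_mul, delS_y_dSeries hq0]

/-- The geometric sum is q^h [h+1]; the normalization absorbs q^h because the binomial exponent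
grows by h from `h` to `h + 1`. -/
theorem delS_y_pathSeries_succ (hq0 : q ≠ 0) (hq2 : q ^ 2 ≠ 1) (h : ℕ) :
    delS q .y (pathSeries q (h + 1)) = qInt q (h + 1) • pathSeries q h := by
  rw [pathSeries, map_smul, delS_mul, delS_y_dSeries hq0, zero_mul, zero_add, twistS_dSeries hq0,
    delS_y_pow_mul hq0, mul_smul_comm, ← qInt_eq_sum hq0 hq2, pathSeries, smul_smul, smul_smul,
    Nat.add_sub_cancel, Nat.choose_succ_succ' h 1, Nat.choose_one_right, pow_add]
  congr 1
  have : q⁻¹ ^ h * q ^ h = 1 := by rw [← mul_pow, inv_mul_cancel₀ hq0, one_pow]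
  linear_combination (q⁻¹ ^ h.choose 2 * qInt q (h + 1)) * this

/-- Differentiating D(q) creates W(q)D(q), which is another Z by the second form of `zSeries`. Its
coefficient q extends the geometric sum from the remaining factors to q^(-h) [h+2]. -/
theorem delS_x_pathSeries (hq0 : q ≠ 0) (hq2 : q ^ 2 ≠ 1) (h : ℕ) :
    delS q .x (pathSeries q h) =
      -(qInt q (h + 2) • (PowerSeries.X * pathSeries q (h + 1))) := by
  have hz : dSeries q q * wSeries q q * dSeries q q * (zSeries q ^ h * dSeries q q⁻¹) =
      dSeries q q * (zSeries q ^ (h + 1) * dSeries q q⁻¹) := by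
    rw [mul_assoc (dSeries q q) (wSeries q q), ← zSeries_eq hq0, pow_succ']
    simp only [mul_assoc]
  have hs : q + q⁻¹ * ∑ i ∈ Finset.range (h + 1), q⁻¹ ^ (2 * i) = q⁻¹ ^ h * qInt q (h + 2) := by
    have h1 := qInt_eq_sum hq0 hq2 (h + 1)
    -- Reversing the sum passes from powers of q to powers of q⁻¹.
    have h2 : ∑ i ∈ Finset.range (h + 2), q ^ (2 * i) =
        q ^ (2 * h + 2) * ∑ i ∈ Finset.range (h + 2), q⁻¹ ^ (2 * i) := by
      rw [← Finset.sum_range_reflect, Finset.mul_sum]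
      refine Finset.sum_congr rfl fun i hi => ?_
      have hi : i < h + 2 := Finset.mem_range.1 hi
      have : 2 * h + 2 = 2 * (h + 2 - 1 - i) + 2 * i := by omega
      rw [this, pow_add, mul_assoc, ← mul_pow, mul_inv_cancel₀ hq0, one_pow, mul_one]
    rw [h2, Finset.sum_range_succ'] at h1
    have h3 : q⁻¹ ^ 2 * ∑ i ∈ Finset.range (h + 1), q⁻¹ ^ (2 * i) =
        ∑ i ∈ Finset.range (h + 1), q⁻¹ ^ (2 * (i + 1)) := by
      rw [Finset.mul_sum]
      exact Finset.sum_congr rfl fun i _ => by ring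
    rw [← h3] at h1
    push_cast at h1
    rw [add_assoc, one_add_one_eq_two] at h1
    generalize (∑ i ∈ Finset.range (h + 1), q⁻¹ ^ (2 * i)) = S at *
    have h4 : q ^ (2 * h + 2) = q ^ (h + 1) * (q ^ h * q) := by ring
    rw [h4, mul_assoc] at h1
    have h5 := mul_left_cancel₀ (pow_ne_zero _ hq0) h1
    have h6 : q⁻¹ ^ h * q ^ h = 1 := by rw [← mul_pow, inv_mul_cancel₀ hq0, one_pow]
    have h7 : q * q⁻¹ = 1 := mul_inv_cancel₀ hq0
    rw [h5]
    linear_combination (-q * (q⁻¹ ^ 2 * S + 1)) * h6 - q⁻¹ * S * h7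
  rw [pathSeries, map_smul, delS_mul, delS_x_dSeries hq0, twistS_dSeries hq0, delS_x_pow_mul hq0,
    neg_mul, smul_mul_assoc, mul_assoc PowerSeries.X, hz, mul_neg, mul_smul_comm,
    ← mul_assoc (dSeries q q) PowerSeries.X,
    (PowerSeries.commute_X (dSeries q q)).eq, mul_assoc PowerSeries.X, ← neg_add, ← add_smul, hs,
    pathSeries, Nat.choose_succ_succ' h 1, Nat.choose_one_right, pow_add, mul_smul_comm, smul_neg,
    smul_smul, smul_smul]
  congr 2
  ring

theorem map_counit_pathSeries (h : ℕ) :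
    PowerSeries.map (counit q) (pathSeries q h) = if h = 0 then 1 else 0 := by
  cases h with
  | zero => simp [pathSeries, map_counit_dSeries]
  | succ h =>
    have h0 : PowerSeries.map (counit q)
        (dSeries q q * (zSeries q ^ (h + 1) * dSeries q q⁻¹)) = 0 := by
      simp [pow_succ, zSeries, map_counit_wSeries]
    ext n
    have := congrArg (PowerSeries.coeff n) h0
    rw [PowerSeries.coeff_map, map_zero] at this
    rw [PowerSeries.coeff_map, pathSeries, PowerSeries.coeff_smul]
    rw [counit_apply, map_smul, ← counit_apply, this]
    simp

variable (q) in
/-- The weight of a word regarded as a nonnegative path from height `h` to `0`. -/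
def pathWeight : ℕ → List Letter → F
  | h, [] => if h = 0 then 1 else 0
  | h, .x :: w => qInt q (h + 2) * pathWeight (h + 1) w
  | 0, .y :: _ => 0
  | h + 1, .y :: w => qInt q (h + 1) * pathWeight h w

theorem pathWeight_eq_zero (w : List Letter) : ∀ h : ℕ, w.length < h → pathWeight q h w = 0 := by
  induction w with
  | nil => intro h hw; rw [pathWeight, if_neg (by simpa using hw.ne')]
  | cons a w ih =>
    intro h hw
    rw [List.length_cons] at hw
    match a, h with
    | .x, h => rw [pathWeight, ih _ (by omega), mul_zero]
    | .y, 0 => rw [pathWeight]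
    | .y, h + 1 => rw [pathWeight, ih _ (by omega), mul_zero]

/-- Deleting letters one at a time follows the path. Each x contributes -t, so `n` counts the x's; a
descent from `h` to 0 then needs `n + h` y's, whence the length condition. -/
theorem wordCoeff_pathSeries (hq0 : q ≠ 0) (hq2 : q ^ 2 ≠ 1) (w : List Letter) :
    ∀ h n : ℕ, wordCoeff q w (PowerSeries.coeff n (pathSeries q h)) =
      if 2 * n + h = w.length then (-1) ^ n * pathWeight q h w else 0 := by
  induction w with
  | nil =>
    intro h n
    have := congrArg (PowerSeries.coeff n) (map_counit_pathSeries (q := q) h)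
    rw [PowerSeries.coeff_map] at this
    refine Eq.trans this ?_
    cases n <;> cases h <;> simp [pathWeight, PowerSeries.coeff_one]
  | cons a w ih =>
    intro h n
    rw [wordCoeff_cons, ← coeff_mapCoeff]
    match a, h with
    | .x, h =>
      rw [delS_x_pathSeries hq0 hq2, map_neg, PowerSeries.coeff_smul, map_neg, map_smul, pathWeight]
      cases n with
      | zero =>
        rw [PowerSeries.coeff_zero_X_mul]
        split_ifs with hw
        -- There is no t left to pay for an ascent, and the remaining word is too short to come down
        -- to 0.
        · rw [pathWeight_eq_zero w (h + 1) (by simp at hw; omega)]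
          simp
        · simp
      | succ n =>
        rw [PowerSeries.coeff_succ_X_mul, ih]
        have : 2 * n + (h + 1) = w.length ↔ 2 * (n + 1) + h = (Letter.x :: w).length := by
          rw [List.length_cons]; omega
        simp only [this]
        split_ifs
        · simp only [smul_eq_mul]; ring
        · simp
    | .y, 0 => rw [delS_y_pathSeries_zero hq0]; simp [pathWeight]
    | .y, h + 1 =>
      rw [delS_y_pathSeries_succ hq0 hq2, PowerSeries.coeff_smul, map_smul, ih, pathWeight]
      have : 2 * n + h = w.length ↔ 2 * n + (h + 1) = (Letter.y :: w).length := by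
        rw [List.length_cons]; omega
      simp only [this]
      split_ifs
      · simp only [smul_eq_mul]; ring
      · simp

/-! ### Comparison with the Catalan weights -/

theorem height_cons (a : Letter) (w : List Letter) : height (a :: w) = a.sign + height w := by
  simp [height]

theorem height_nil : height [] = 0 := rfl

/-- A path weight has a factor for the height reached by each step but none for the starting height;
`qInt q (h + 1)` restores it, matching the product over all prefixes. -/
theorem qInt_mul_pathWeight (w : List Letter) : ∀ h : ℕ,
    qInt q (h + 1) * pathWeight q h w =
      if (∀ i ∈ Finset.range w.length, 0 ≤ h + height (w.take i)) ∧ h + height w = 0 then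
        ∏ i ∈ Finset.range (w.length + 1), qInt q (1 + h + height (w.take i)) else 0 := by
  induction w with
  | nil =>
    intro h
    cases h
    · simp [pathWeight, height_nil]
    · rw [pathWeight, if_neg (by omega), if_neg, mul_zero]
      simp only [height_nil]
      omega
  | cons a w ih =>
    intro h
    have hc (P : ℕ → Prop) : (∀ i ∈ Finset.range (w.length + 1), P i) ↔
        P 0 ∧ ∀ i ∈ Finset.range w.length, P (i + 1) := by
      simp only [Finset.mem_range]
      refine ⟨fun H => ⟨H 0 (by omega), fun i hi => H _ (by omega)⟩, fun H i hi => ?_⟩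
      cases i with
      | zero => exact H.1
      | succ i => exact H.2 i (by omega)
    rw [List.length_cons, Finset.prod_range_succ']
    simp only [hc, List.take_succ_cons, List.take_zero, height_cons, height_nil, add_zero,
      Int.natCast_nonneg, true_and]
    match a, h with
    | .x, h =>
      have ih := ih (h + 1)
      push_cast at ih
      rw [pathWeight, show (h : ℤ) + 2 = h + 1 + 1 by ring, ih]
      simp only [Letter.sign, add_assoc]
      split_ifs
      · rw [mul_comm, add_comm (h : ℤ) 1]
      · simp
    | .y, 0 =>
      rw [pathWeight, mul_zero, if_neg]
      rintro ⟨H, H'⟩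
      -- The nonnegativity condition covers proper prefixes only, so the single letter y must be
      -- excluded by its final height.
      cases w with
      | nil => simp [Letter.sign, height_nil] at H'
      | cons b w => simpa [Letter.sign, height_nil] using H 0 (by simp)
    | .y, h + 1 =>
      rw [pathWeight, ih h]
      push_cast
      have e (z : ℤ) : (h : ℤ) + 1 + (-1 + z) = h + z := by ring
      have e' (z : ℤ) : 1 + ((h : ℤ) + 1) + (-1 + z) = 1 + h + z := by ring
      simp only [Letter.sign, e, e']
      split_ifs
      · rw [mul_comm, add_comm (1 : ℤ) (h + 1)]
      · simp

theorem pathWeight_zero (hq2 : q - q⁻¹ ≠ 0) (w : List Letter) :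
    pathWeight q 0 w = if IsCatalan w then catalanCoeff q w else 0 := by
  have h := qInt_mul_pathWeight (q := q) w 0
  have h1 : qInt q 1 = 1 := by simp [qInt, div_self hq2]
  simpa [h1, IsCatalan, catalanCoeff] using h

theorem wordCoeff_C (n : ℕ) (w : List Letter) :
    wordCoeff q w (C q n) =
      if 2 * n = w.length then (if IsCatalan w then catalanCoeff q w else 0) else 0 := by
  rw [C, map_sum]
  have key (v : Fin (2 * n) → Letter) : wordCoeff q w (if IsCatalan (List.ofFn v) then
      catalanCoeff q (List.ofFn v) • word q (List.ofFn v) else 0) =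
      if List.ofFn v = w then (if IsCatalan w then catalanCoeff q w else 0) else 0 := by
    by_cases hv : List.ofFn v = w
    · subst hv
      rw [if_pos rfl]
      split_ifs <;> simp [wordCoeff_word]
    · split_ifs <;> simp [wordCoeff_word, hv]
  simp only [key]
  by_cases hw : 2 * n = w.length
  · obtain ⟨v, rfl⟩ : ∃ v : Fin (2 * n) → Letter, List.ofFn v = w :=
      ⟨fun i => w.get (i.cast hw), List.ext_get (by simp [hw]) fun i h1 h2 => by simp⟩
    simp only [List.ofFn_injective.eq_iff, Finset.sum_ite_eq', Finset.mem_univ, if_true,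
      List.length_ofFn]
  · rw [if_neg hw]
    refine Finset.sum_eq_zero fun v _ => if_neg ?_
    rintro rfl
    simp at hw

theorem genFun_C (hq0 : q ≠ 0) (hq2 : q ^ 2 ≠ 1) :
    genFun q (C q) (-1) = dSeries q q * dSeries q q⁻¹ := by
  have hd : q - q⁻¹ ≠ 0 := by
    intro h
    apply hq2
    field_simp at h
    linear_combination h
  have h0 : pathSeries q 0 = dSeries q q * dSeries q q⁻¹ := by simp [pathSeries]
  rw [← h0]
  ext n
  refine ext_wordCoeff q fun w => ?_
  rw [wordCoeff_pathSeries hq0 hq2, coeff_genFun, map_smul, wordCoeff_C, pathWeight_zero hd,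
    add_zero, smul_eq_mul, mul_ite, mul_zero]

end

end QShuffle

theorem proposition11p9 {F : Type*} [Field F] (q : F) (hq0 : q ≠ 0)
    (hq : ∀ n : ℕ, 1 ≤ n → q ^ n ≠ 1) :
    QShuffle.genFun q (QShuffle.C q) (-1) =
        QShuffle.genFun q (QShuffle.D q) q * QShuffle.genFun q (QShuffle.D q) q⁻¹ ∧
      ∀ n : ℕ, QShuffle.C q n =
        (-1 : F) ^ n • ∑ i ∈ Finset.range (n + 1),
          q ^ (2 * (i : ℤ) - (n : ℤ)) • (QShuffle.D q i * QShuffle.D q (n - i)) := by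
  have key := QShuffle.genFun_C hq0 (hq 2 one_le_two)
  refine ⟨key, fun n => ?_⟩
  have h := congrArg (PowerSeries.coeff n) key
  rw [QShuffle.coeff_genFun, PowerSeries.coeff_mul,
    Finset.Nat.sum_antidiagonal_eq_sum_range_succ_mk] at h
  have h1 : QShuffle.C q n = (-1 : F) ^ n • (-1 : F) ^ n • QShuffle.C q n := by
    rw [smul_smul, ← mul_pow]
    simp
  rw [h1, h]
  congr 1
  refine Finset.sum_congr rfl fun i hi => ?_
  have hi : i ≤ n := by simpa [Nat.lt_succ_iff] using hi
  rw [QShuffle.coeff_genFun, QShuffle.coeff_genFun, smul_mul_smul_comm]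
  congr 1
  rw [← zpow_natCast, inv_pow, ← zpow_natCast, ← zpow_neg, ← zpow_add₀ hq0, Nat.cast_sub hi]
  congr 1
  ring
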